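/- **Model.** A source stores an array $X\in\{0,1\}^n$. There are $k$ peers with distinct identities, $1\le k\le n$, $n\ge 2$. Computation is synchronous. In each round every peer generates private independent fair random bits, sends the source a set of queries (each an index $i\in\{1,\dots,n\}$), receives the replies $X_i$, and then broadcasts one message (a bit string, possibly empty), which is delivered to all peers with the identity of its sender; every peer, corrupt or not, sends the same message to all. The queries depend on what the peer knows about earlier rounds and on its new random bits; the message may also depend on the replies of the same round. After the last round each peer outputs an array of $n$ bits. The parameters $n,k,\beta$ are known to the peers. **Adversary.** Let $\beta\in[0,1)$ and $\gamma=1-\beta$. A dynamic Byzantine adversary, which knows $X$ and the protocol, chooses at the start of every round an arbitrary new set of at most $\beta k$ corrupt peers, depending on all random bits, replies and messages of the earlier rounds; a peer may be corrupt in one round and nonfaulty in the next. In a round in which it is corrupt, a peer broadcasts an arbitrary message, and its private record of its random bits and source replies of that round is arbitrary too; this behaviour may even depend on the random bits generated by all peers in that round. In a round in which it is not corrupt, a peer follows the protocol. Broadcast messages are always delivered and recorded. **Theorem.** For every $c>0$ there is a constant $C>0$, depending only on $c$, such that for all integers $n\ge 2$, $1\le k\le n$ and all $\beta\in[0,1)$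 there is a randomized protocol (depending on $n,k,\beta,c$ only) in the broadcast model such that, for every input $X$ and every dynamic Byzantine adversary as above: 1. in every execution the protocol terminates after at most $C\log^2 n$ rounds; 2. in every execution, each peer makes at most $C\,\frac{n}{\gamma k}\log^2 n$ queries in total over the rounds in which it is nonfaulty; 3. in every execution, each message sent by a peer in a round in which it is nonfaulty has at most $C\,\frac{n}{\gamma k}\log n$ bits; 4. with probability at least $1-n^{-c}$ over the random bits, Download is solved: every peer that is nonfaulty in the last round outputs $X$. -/

import Mathlib

namespace DataRetrieval

/-- The input array `X` of `n` bits held by the source. -/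
abbrev Input (n : ℕ) := Fin n → Bool

/-- The random bits generated by the `k` peers in one round, `b` bits per peer. -/
abbrev Coins (k b : ℕ) := Fin k → Fin b → Bool

/-- The record of one peer for one round: the random bits it generated, the replies of the source
(`none` at the indices that were not queried) and the bit string it broadcast (the empty string
stands for silence). -/
structure PeerRound (n b : ℕ) where
  coins : Fin b → Bool
  replies : Fin n → Option Bool
  message : List Bool

/-- A full history: one record per peer for every past round, in chronological order. -/
abbrev History (n k b : ℕ) := List (Fin k → PeerRound n b)

/-- What a peer knows about one past round: its own random bits, its own replies from the source,
and the messages received. Communication is by broadcast: there is one message per sender, the same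
for all receivers, and the identity of the sender is known. -/
structure LocalRound (n k b : ℕ) where
  coins : Fin b → Bool
  replies : Fin n → Option Bool
  received : Fin k → List Bool

/-- The local view of a peer: what it knows about all past rounds, in chronological order. -/
abbrev LocalView (n k b : ℕ) := List (LocalRound n k b)

/-- The part of the history that peer `v` sees. -/
def localView {n k b : ℕ} (v : Fin k) (h : History n k b) : LocalView n k b :=
  h.map fun r => ⟨(r v).coins, (r v).replies, fun w => (r w).message⟩

/-- A synchronous randomized protocol for `k` peers in the broadcast model with an `n`-bit source.
In each round a peer generates `coinBits` random bits, sends a set of queries, gets the replies, and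
then broadcasts a message. After the last round it outputs a bit array. Local computation is
free. -/
structure Protocol (n k : ℕ) where
  /-- number of rounds until termination -/
  rounds : ℕ
  /-- number of random bits a peer generates per round -/
  coinBits : ℕ
  /-- the indices to query, from the local view and the random bits of the current round -/
  query : Fin k → LocalView n k coinBits → (Fin coinBits → Bool) → Finset (Fin n)
  /-- the message to broadcast, which may also depend on the replies of the current round -/
  message : Fin k → LocalView n k coinBits → (Fin coinBits → Bool) → (Fin n → Option Bool) →
    List Bool
  /-- the output, from the local view after the last round -/
  output : Fin k → LocalView n k coinBits → Fin n → Bool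

/-- A dynamic Byzantine adversary. At the start of every round it chooses, from the whole past
(all random bits, replies and messages), an arbitrary new set of at most `β * k` corrupt peers.
The record of each peer that is corrupt in this round is then arbitrary: its message, and also what
the peer will later remember of its own random bits and replies of this round. The behaviour of
the corrupt peers may also depend on the random bits generated by all peers in this round. -/
structure Adversary (n k b : ℕ) (β : ℝ) where
  corrupt : History n k b → Finset (Fin k)
  corrupt_card_le : ∀ h, ((corrupt h).card : ℝ) ≤ β * k
  behave : History n k b → Coins k b → Fin k → PeerRound n b

namespace Protocol

variable {n k : ℕ} (P : Protocol n k)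

/-- The record of a peer `v` that obeys the protocol in a round, given the past `h` and its random
bits `c` for this round. -/
def honestRound (X : Input n) (h : History n k P.coinBits) (v : Fin k)
    (c : Fin P.coinBits → Bool) : PeerRound n P.coinBits :=
  let Q := P.query v (localView v h) c
  let replies : Fin n → Option Bool := fun i => if i ∈ Q then some (X i) else none
  ⟨c, replies, P.message v (localView v h) c replies⟩

variable {β : ℝ} (X : Input n) (A : Adversary n k P.coinBits β)

/-- The records of all peers for the round that follows the past `h`. -/
def nextRound (h : History n k P.coinBits) (c : Coins k P.coinBits) :
    Fin k → PeerRound n P.coinBits :=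
  fun v => if v ∈ A.corrupt h then A.behave h c v else P.honestRound X h v (c v)

/-- The history of the first `t` rounds of the execution with input `X`, adversary `A` and random
bits `ω`. -/
def history (ω : Fin P.rounds → Coins k P.coinBits) :
    (t : ℕ) → t ≤ P.rounds → History n k P.coinBits
  | 0, _ => []
  | t + 1, ht =>
    let past := history ω t (Nat.le_of_succ_le ht)
    past ++ [P.nextRound X A past (ω ⟨t, ht⟩)]

/-- The history of the rounds before round `t`. -/
def pastOf (ω : Fin P.rounds → Coins k P.coinBits) (t : Fin P.rounds) :
    History n k P.coinBits :=
  P.history X A ω t t.isLt.le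

/-- Peer `v` is nonfaulty in round `t`. -/
def Nonfaulty (ω : Fin P.rounds → Coins k P.coinBits) (t : Fin P.rounds) (v : Fin k) : Prop :=
  v ∉ A.corrupt (P.pastOf X A ω t)

open scoped Classical in
/-- The number of queries that peer `v` makes in the execution, in those rounds in which it is
nonfaulty. -/
noncomputable def queryCost (ω : Fin P.rounds → Coins k P.coinBits) (v : Fin k) : ℕ :=
  ∑ t : Fin P.rounds, if P.Nonfaulty X A ω t v then
    (P.query v (localView v (P.pastOf X A ω t)) (ω t v)).card else 0

/-- The number of bits of the message that the protocol prescribes to peer `v` in round `t`. -/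
def messageSize (ω : Fin P.rounds → Coins k P.coinBits) (t : Fin P.rounds) (v : Fin k) : ℕ :=
  (P.honestRound X (P.pastOf X A ω t) v (ω t v)).message.length

/-- The execution solves Download: each peer that is nonfaulty in the last round (whether or not it
was corrupt before) outputs the whole input array. -/
def SolvesDownload (ω : Fin P.rounds → Coins k P.coinBits) : Prop :=
  ∀ v : Fin k, (∀ t : Fin P.rounds, (t : ℕ) + 1 = P.rounds → P.Nonfaulty X A ω t v) →
    P.output v (localView v (P.history X A ω P.rounds le_rfl)) = X

/-- The probability that Download is solved, where all random bits of all peers are independent and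
fair, that is, all choices of `ω` are equally likely. -/
noncomputable def successProb : ℝ :=
  (Nat.card {ω : Fin P.rounds → Coins k P.coinBits // P.SolvesDownload X A ω} : ℝ) /
    Nat.card (Fin P.rounds → Coins k P.coinBits)

end Protocol

end DataRetrieval

/-! All messages are public, so all peers share a set of candidate inputs, initially everything.
Only indices in a least set separating the candidates need to be learnt. In round `t` this set is
dealt into `m = 2 ^ (b - t)` blocks; each peer queries a random block and broadcasts its coins and
the bits seen. A candidate survives if each block has at least `γ * k / (2 * m)` announcements
agreeing with it.

The truth survives: the corrupt set is fixed before the round's coins, so about `γ * k / m` or more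
nonfaulty peers hit each block, and a Chernoff bound (`card_few_hits_le`) with a union bound
excludes a count below half of that. Few indices remain: one message supports at most one bit
pattern on one block, so at most `2 * m / γ` patterns survive over all blocks, and a family is
separated by as many indices as it has members (`card_sepSet_survivors_mul_le`). With `m` halved,
the next queries cost `O(1 / γ)` each. In the last round there is one block, every peer reads the
whole separating set, and a single candidate fits. With `2 ^ b` about `γ * k / log n`, the first
round costs `O(n * log n / (γ * k))` per peer. -/

namespace DataRetrieval

open Finset
open scoped Classical

/-! ### Separating sets of indices -/

/-- A set of indices on which any two distinct members of `F` differ. -/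
def IsSeparating {n : ℕ} (F : Finset (Input n)) (S : Finset (Fin n)) : Prop :=
  ∀ Y ∈ F, ∀ Z ∈ F, (∀ i ∈ S, Y i = Z i) → Y = Z

/-- Induction on `F`: a set separating the old members leaves at most one of them equal to the new
member on it, and one further index tells these two apart. -/
theorem exists_isSeparating_card_le {n : ℕ} (F : Finset (Input n)) :
    ∃ S, IsSeparating F S ∧ #S ≤ #F := by
  induction F using Finset.induction_on with
  | empty => exact ⟨∅, by simp [IsSeparating], by simp⟩
  | insert a F ha ih =>
    obtain ⟨S, hS, hcard⟩ := ih
    rw [card_insert_of_notMem ha]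
    by_cases h : ∃ Y ∈ F, ∀ i ∈ S, Y i = a i
    · obtain ⟨Y, hY, hYa⟩ := h
      have hne : Y ≠ a := fun h => ha (h ▸ hY)
      obtain ⟨i₀, hi₀⟩ := Function.ne_iff.mp hne
      have key : ∀ Z ∈ F, (∀ i ∈ insert i₀ S, Z i = a i) → False := by
        intro Z hZ hag
        have : Z = Y := hS Z hZ Y hY fun i hi => by
          rw [hag i (mem_insert_of_mem hi), hYa i hi]
        exact hi₀ (this ▸ hag i₀ (mem_insert_self _ _))
      refine ⟨insert i₀ S, ?_, (card_insert_le _ _).trans (by omega)⟩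
      intro Y' hY'' Z hZ' hag
      rcases mem_insert.mp hY'' with rfl | hY' <;> rcases mem_insert.mp hZ' with rfl | hZ
      · rfl
      · exact (key Z hZ fun i hi => (hag i hi).symm).elim
      · exact (key Y' hY' hag).elim
      · exact hS _ hY' _ hZ fun i hi => hag i (mem_insert_of_mem hi)
    · push Not at h
      refine ⟨S, ?_, by omega⟩
      intro Y' hY'' Z hZ' hag
      rcases mem_insert.mp hY'' with rfl | hY' <;> rcases mem_insert.mp hZ' with rfl | hZ
      · rfl
      · obtain ⟨i, hi, hne⟩ := h Z hZ
        exact (hne (hag i hi).symm).elim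
      · obtain ⟨i, hi, hne⟩ := h Y' hY'
        exact (hne (hag i hi)).elim
      · exact hS _ hY' _ hZ hag

theorem exists_min_isSeparating {n : ℕ} (F : Finset (Input n)) :
    ∃ S, IsSeparating F S ∧ ∀ S', IsSeparating F S' → #S ≤ #S' := by
  obtain ⟨S₀, h₀, -⟩ := exists_isSeparating_card_le F
  obtain ⟨S, hS, hmin⟩ := exists_min_image (univ.filter (IsSeparating F)) card ⟨S₀, by simpa⟩
  exact ⟨S, by simpa using hS, fun S' h => hmin S' (by simpa)⟩

/-- A separating set of `F` of least cardinality. -/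
noncomputable def sepSet {n : ℕ} (F : Finset (Input n)) : Finset (Fin n) :=
  (exists_min_isSeparating F).choose

theorem isSeparating_sepSet {n : ℕ} (F : Finset (Input n)) : IsSeparating F (sepSet F) :=
  (exists_min_isSeparating F).choose_spec.1

theorem card_sepSet_le {n : ℕ} {F : Finset (Input n)} {S : Finset (Fin n)}
    (h : IsSeparating F S) : #(sepSet F) ≤ #S :=
  (exists_min_isSeparating F).choose_spec.2 S h

/-! ### Blocks, random block choice and announcements -/

/-- The number of elements of `S` below `i`. -/
def rankIn {n : ℕ} (S : Finset (Fin n)) (i : Fin n) : ℕ := #{x ∈ S | x < i}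

theorem rankIn_strictMonoOn {n : ℕ} (S : Finset (Fin n)) :
    StrictMonoOn (rankIn S) (S : Set (Fin n)) := by
  intro i hi j _ hij
  refine card_lt_card ((ssubset_iff_of_subset ?_).mpr ⟨i, ?_, ?_⟩)
  · intro x hx
    simp only [mem_filter] at hx ⊢
    exact ⟨hx.1, hx.2.trans hij⟩
  · simpa using ⟨hi, hij⟩
  · simp

theorem rankIn_lt_card {n : ℕ} {S : Finset (Fin n)} {i : Fin n} (hi : i ∈ S) :
    rankIn S i < #S :=
  card_lt_card ((ssubset_iff_of_subset (filter_subset _ _)).mpr ⟨i, hi, by simp⟩)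

/-- The `j`-th block when `S` is dealt out into `m` blocks of almost equal size. -/
def block {n : ℕ} (S : Finset (Fin n)) (m j : ℕ) : Finset (Fin n) :=
  {i ∈ S | rankIn S i % m = j}

/-- Ranks within a block agree modulo `m`, so their quotients by `m` are distinct, and these are at
most `#S / m`. -/
theorem card_block_le {n : ℕ} (S : Finset (Fin n)) (m j : ℕ) :
    #(block S m j) ≤ #S / m + 1 := by
  rw [← card_range (#S / m + 1)]
  refine card_le_card_of_injOn (fun i => rankIn S i / m) ?_ ?_
  · intro i hi
    have hi' : i ∈ block S m j := hi
    simp only [block, mem_filter] at hi'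
    have := Nat.div_le_div_right (c := m) (rankIn_lt_card hi'.1).le
    simp only [coe_range, Set.mem_Iio]
    omega
  · intro i hi i' hi' h
    simp only [block, coe_filter, Set.mem_ofPred_eq] at hi hi' h
    refine (rankIn_strictMonoOn S).injOn hi.1 hi'.1 ?_
    rw [← Nat.div_add_mod (rankIn S i) m, ← Nat.div_add_mod (rankIn S i') m, h, hi.2, hi'.2]

theorem mem_block_rankIn {n : ℕ} {S : Finset (Fin n)} {i : Fin n} (hi : i ∈ S) (m : ℕ) :
    i ∈ block S m (rankIn S i % m) := by
  simp [block, hi]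

theorem block_one {n : ℕ} (S : Finset (Fin n)) : block S 1 0 = S := by
  ext i; simp [block, Nat.mod_one]

/-- An enumeration of the strings of `b` random bits. -/
noncomputable def coinEquiv (b : ℕ) : (Fin b → Bool) ≃ Fin (2 ^ b) :=
  Fintype.equivFinOfCardEq (by simp)

/-- The block, out of `m`, that is selected by the random bits `c`. -/
noncomputable def cell {b : ℕ} (m : ℕ) (c : Fin b → Bool) : ℕ := (coinEquiv b c : ℕ) % m

/-- Since `m` divides `2 ^ b`, residues modulo `m` are exactly equidistributed; the Chernoff bound
uses this density `1 / m`. -/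
theorem card_cell_eq {b m j : ℕ} (hm : m ∣ 2 ^ b) (hj : j < m) :
    #{c : Fin b → Bool | cell m c = j} * m = 2 ^ b := by
  have hm0 : 0 < m := by omega
  obtain ⟨q, hq⟩ := hm
  have h1 : #{c : Fin b → Bool | cell m c = j} = #(range q) := by
    symm
    refine card_bij' (fun x hx => (coinEquiv b).symm ⟨x * m + j, ?_⟩)
      (fun c _ => (coinEquiv b c : ℕ) / m) ?_ ?_ ?_ ?_
    · rw [hq]
      have : x + 1 ≤ q := mem_range.mp hx
      nlinarith
    · intro x hx
      refine mem_filter.mpr ⟨mem_univ _, ?_⟩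
      simp [cell, Nat.add_mod, Nat.mod_eq_of_lt hj]
    · intro c hc
      rw [mem_range]
      apply Nat.div_lt_of_lt_mul
      rw [← hq]
      exact (coinEquiv b c).2
    · intro x hx
      simp only [Equiv.apply_symm_apply]
      rw [Nat.mul_comm, Nat.mul_add_div hm0, Nat.div_eq_of_lt hj, add_zero]
    · intro c hc
      replace hc : (coinEquiv b c : ℕ) % m = j := (mem_filter.mp hc).2
      rw [Equiv.symm_apply_eq]
      ext
      simp only
      conv_rhs => rw [← Nat.div_add_mod (coinEquiv b c : ℕ) m, hc]
      ring
  rw [h1, card_range, hq, Nat.mul_comm]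

/-- The message of a peer with random bits `c` that announces the bits of `Y` on `B`. -/
noncomputable def announce {n b : ℕ} (c : Fin b → Bool) (B : Finset (Fin n)) (Y : Input n) :
    List Bool :=
  List.ofFn c ++ B.toList.map Y

theorem length_announce {n b : ℕ} (c : Fin b → Bool) (B : Finset (Fin n)) (Y : Input n) :
    (announce c B Y).length = b + #B := by
  simp [announce]

/-- The coins form a prefix of fixed length `b`. A message therefore determines the block it speaks
about. -/
theorem announce_coins_inj {n b : ℕ} {c c' : Fin b → Bool} {B B' : Finset (Fin n)}
    {Y Y' : Input n} (h : announce c B Y = announce c' B' Y') : c = c' :=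
  List.ofFn_injective (List.append_inj_left h (by simp))

theorem announce_eq_iff {n b : ℕ} {c : Fin b → Bool} {B : Finset (Fin n)} {Y Y' : Input n} :
    announce c B Y = announce c B Y' ↔ ∀ i ∈ B, Y i = Y' i := by
  simp [announce, List.map_inj_left]

/-! ### Support counting and surviving candidates -/

variable {n k b : ℕ}

/-- The peers whose message, in a round with `m` blocks and candidates `F`, announces the bits of
`Y` on the block `j`. -/
noncomputable def supporters (b m : ℕ) (F : Finset (Input n)) (msgs : Fin k → List Bool) (j : ℕ)
    (Y : Input n) : Finset (Fin k) :=
  {v | ∃ c : Fin b → Bool, cell m c = j ∧ msgs v = announce c (block (sepSet F) m j) Y}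

/-- The candidates that survive a round: those with at least `γ * k / (2 * m)` supporters on each
block. -/
noncomputable def survivors (b : ℕ) (γ : ℝ) (m : ℕ) (F : Finset (Input n))
    (msgs : Fin k → List Bool) : Finset (Input n) :=
  {Y ∈ F | ∀ j < m, γ * k / (2 * m) ≤ #(supporters b m F msgs j Y)}

/-- The restriction of `Y` to `B`, extended by `false`. -/
def mask (B : Finset (Fin n)) (Y : Input n) : Input n := fun i => if i ∈ B then Y i else false

theorem supporters_mask (m : ℕ) (F : Finset (Input n)) (msgs : Fin k → List Bool) (j : ℕ)
    (Y : Input n) :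
    supporters b m F msgs j (mask (block (sepSet F) m j) Y) = supporters b m F msgs j Y := by
  have h (c : Fin b → Bool) : announce c (block (sepSet F) m j) (mask (block (sepSet F) m j) Y) =
      announce c (block (sepSet F) m j) Y :=
    announce_eq_iff.mpr fun i hi => if_pos hi
  simp only [supporters, h]

/-- Double counting: the pairs (block, surviving pattern) have disjoint supporter sets, each as
large as the threshold, among `k` peers. Separating the patterns block by block separates the
survivors and costs at most one index per pair. -/
theorem card_sepSet_survivors_mul_le {γ : ℝ} {m : ℕ} (hm : 0 < m) (F : Finset (Input n))
    (msgs : Fin k → List Bool) :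
    (#(sepSet (survivors b γ m F msgs)) : ℝ) * (γ * k / (2 * m)) ≤ k := by
  set F' := survivors b γ m F msgs with hF'
  rcases le_or_gt (γ * k / (2 * m)) 0 with hT | hT
  · exact (mul_nonpos_of_nonneg_of_nonpos (by positivity) hT).trans (by positivity)
  let B : ℕ → Finset (Fin n) := block (sepSet F) m
  -- Masking identifies survivors with the same pattern on block `j`, so each pattern is counted
  -- once.
  let A : ℕ → Finset (Input n) := fun j => F'.image (mask (B j))
  choose S hS hSc using fun j => exists_isSeparating_card_le (A j)
  have hsep : IsSeparating F' ((range m).biUnion S) := by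
    intro Y hY Z hZ hag
    refine isSeparating_sepSet F Y (mem_filter.mp hY).1 Z (mem_filter.mp hZ).1 fun i hi => ?_
    have hj : rankIn (sepSet F) i % m ∈ range m := mem_range.mpr (Nat.mod_lt _ hm)
    have hiB : i ∈ B (rankIn (sepSet F) i % m) := mem_block_rankIn hi m
    have := hS (rankIn (sepSet F) i % m) _ (mem_image_of_mem _ hY) _ (mem_image_of_mem _ hZ)
      fun x hx => by
        have := hag x (mem_biUnion.mpr ⟨_, hj, hx⟩)
        simp only [mask, this]
    simpa [mask, hiB] using congrFun this i
  have hdisj : ((range m).sigma A : Set (Σ _ : ℕ, Input n)).PairwiseDisjoint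
      (fun p => supporters b m F msgs p.1 p.2) := by
    rintro ⟨j, a⟩ hp ⟨j', a'⟩ hp' hne
    refine disjoint_left.mpr fun v hv hv' => hne ?_
    simp only [supporters, mem_filter, mem_univ, true_and] at hv hv'
    obtain ⟨c, hc, h⟩ := hv
    obtain ⟨c', hc', h'⟩ := hv'
    have heq := h.symm.trans h'
    obtain rfl := announce_coins_inj heq
    obtain rfl : j = j' := hc.symm.trans hc'
    rw [announce_eq_iff] at heq
    simp only [coe_sigma, Set.mem_sigma_iff, A, coe_image, Set.mem_image] at hp hp'
    obtain ⟨-, Y, -, rfl⟩ := hp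
    obtain ⟨-, Y', -, rfl⟩ := hp'
    congr 1
    ext1 i
    by_cases hi : i ∈ B j
    · exact heq i hi
    · simp [mask, hi]
  have hsupp : ∀ p ∈ (range m).sigma A,
      γ * k / (2 * m) ≤ #(supporters b m F msgs p.1 p.2) := by
    rintro ⟨j, a⟩ hp
    simp only [mem_sigma, mem_range, A, mem_image] at hp
    obtain ⟨hj, Y, hY, rfl⟩ := hp
    simp only [B, supporters_mask]
    exact (mem_filter.mp hY).2 j hj
  have hcard : #(sepSet F') ≤ #((range m).sigma A) := by
    refine (card_sepSet_le hsep).trans (card_biUnion_le.trans ?_)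
    rw [card_sigma]
    exact sum_le_sum fun j _ => hSc j
  calc (#(sepSet F') : ℝ) * (γ * k / (2 * m))
      ≤ #((range m).sigma A) * (γ * k / (2 * m)) := by gcongr
    _ = ∑ p ∈ (range m).sigma A, γ * k / (2 * m) := by simp
    _ ≤ ∑ p ∈ (range m).sigma A, (#(supporters b m F msgs p.1 p.2) : ℝ) := sum_le_sum hsupp
    _ = (#(((range m).sigma A).biUnion fun p => supporters b m F msgs p.1 p.2) : ℕ) := by
      rw [card_biUnion hdisj]; push_cast; rfl
    _ ≤ k := by exact_mod_cast (card_le_univ _).trans (by simp)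

/-! ### The candidate sets over the rounds, and the protocol -/

/-- The number of past rounds, and the inputs that are consistent with the messages of these
rounds. -/
noncomputable def candidateState (b : ℕ) (γ : ℝ) (L : List (Fin k → List Bool)) :
    ℕ × Finset (Input n) :=
  L.foldl (fun s msgs => (s.1 + 1, survivors b γ (2 ^ (b - s.1)) s.2 msgs)) (0, univ)

/-- The inputs that are consistent with the messages `L` of the past rounds. -/
noncomputable def candidates (b : ℕ) (γ : ℝ) (L : List (Fin k → List Bool)) :
    Finset (Input n) :=
  (candidateState b γ L).2

theorem candidateState_fst (γ : ℝ) (L : List (Fin k → List Bool)) :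
    (candidateState (n := n) b γ L).1 = L.length := by
  induction L using List.reverseRecOn with
  | nil => rfl
  | append_singleton L msgs ih =>
    simp only [candidateState, List.foldl_append, List.foldl_cons, List.foldl_nil,
      List.length_append, List.length_singleton] at ih ⊢
    rw [ih]

theorem candidates_append (γ : ℝ) (L : List (Fin k → List Bool)) (msgs : Fin k → List Bool) :
    candidates (n := n) b γ (L ++ [msgs]) =
      survivors b γ (2 ^ (b - L.length)) (candidates b γ L) msgs := by
  rw [← candidateState_fst (n := n) (b := b) γ L]
  simp [candidates, candidateState, List.foldl_append]

/-- The block that a peer with random bits `c` queries when the past messages are `L`. -/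
noncomputable def queryBlock (b : ℕ) (γ : ℝ) (L : List (Fin k → List Bool)) (c : Fin b → Bool) :
    Finset (Fin n) :=
  block (sepSet (candidates b γ L)) (2 ^ (b - L.length)) (cell (2 ^ (b - L.length)) c)

/-- In the first round the separating set has at most `n` indices in `2 ^ b` blocks. Later, a round
with `2 * M` blocks leaves at most `4 * M / γ` indices for `M` blocks. Rounding up adds 1, absorbed
by `1 / γ`. -/
theorem card_queryBlock_le {γ : ℝ} (hγ : 0 < γ) (hγ1 : γ ≤ 1) (hk : 0 < k)
    (L : List (Fin k → List Bool)) (hL : L.length ≤ b) (c : Fin b → Bool) :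
    (#(queryBlock (n := n) b γ L c) : ℝ) ≤ n / 2 ^ b + 5 / γ := by
  have hk' : (0 : ℝ) < k := by exact_mod_cast hk
  have hone : 1 ≤ 1 / γ := by rw [le_div_iff₀ hγ]; linarith
  have h5 : 5 / γ = 5 * (1 / γ) := by ring
  have h1 : (#(queryBlock (n := n) b γ L c) : ℝ) ≤
      #(sepSet (candidates (n := n) b γ L)) / 2 ^ (b - L.length) + 1 := by
    have := card_block_le (sepSet (candidates (n := n) b γ L)) (2 ^ (b - L.length))
      (cell (2 ^ (b - L.length)) c)
    calc (#(queryBlock (n := n) b γ L c) : ℝ) ≤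
        ((#(sepSet (candidates (n := n) b γ L)) / 2 ^ (b - L.length) : ℕ) : ℝ) + 1 := by
          exact_mod_cast this
      _ ≤ _ := by
        gcongr
        exact_mod_cast Nat.cast_div_le (α := ℝ)
  rcases List.eq_nil_or_concat L with rfl | ⟨L', msgs, rfl⟩
  · have h2 : #(sepSet (candidates (n := n) b γ ([] : List (Fin k → List Bool)))) ≤ n :=
      (card_le_univ _).trans (by simp)
    refine h1.trans ?_
    simp only [List.length_nil, Nat.sub_zero]
    have : (#(sepSet (candidates (n := n) b γ ([] : List (Fin k → List Bool)))) : ℝ) / 2 ^ b ≤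
        n / 2 ^ b := by gcongr
    linarith
  · simp only [List.concat_eq_append, List.length_append, List.length_singleton] at *
    rw [candidates_append] at h1
    have h2 := card_sepSet_survivors_mul_le (b := b) (γ := γ) (m := 2 ^ (b - L'.length)) (by positivity)
      (candidates (n := n) b γ L') msgs
    set s : ℝ :=
      (#(sepSet (survivors b γ (2 ^ (b - L'.length)) (candidates (n := n) b γ L') msgs)) : ℝ)
    have hpow : (2 : ℝ) ^ (b - L'.length) = 2 * 2 ^ (b - (L'.length + 1)) := by
      rw [← pow_succ']; congr 1; omega
    push_cast at h2
    rw [hpow] at h2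
    set M : ℝ := 2 ^ (b - (L'.length + 1))
    have hM : 0 < M := by positivity
    have h3 : s / M ≤ 4 * (1 / γ) := by
      rw [mul_one_div, div_le_div_iff₀ hM hγ]
      rw [mul_div_assoc', div_le_iff₀ (by positivity)] at h2
      have : (s * γ) * k ≤ (4 * M) * k := by linarith
      exact le_of_mul_le_mul_right this hk'
    have : (0 : ℝ) ≤ n / 2 ^ b := by positivity
    linarith

/-- The Download protocol. In each round every peer queries a random block of the indices that
separate the candidates that are left, and broadcasts the bits that it sees; the number of blocks is
halved from round to round, so that in the last round there is only one. -/
noncomputable abbrev downloadProtocol (n k b : ℕ) (γ : ℝ) : Protocol n k where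
  rounds := b + 1
  coinBits := b
  query _ l c := queryBlock b γ (l.map LocalRound.received) c
  message _ l c r :=
    announce c (queryBlock b γ (l.map LocalRound.received) c) fun i => (r i).getD false
  -- Only the replies of the last round are used besides the public messages, since records of
  -- earlier rounds may have been falsified.
  output _ l := Classical.epsilon fun Y : Input n => ∃ l' r, l = l' ++ [r] ∧
    Y ∈ candidates b γ (l'.map LocalRound.received) ∧ ∀ i x, r.replies i = some x → Y i = x

/-! ### Probability by counting -/

/-- A Chernoff bound, in counting form, for the lower tail of the number of those `v ∈ H` for which
`x v` lies in a set of density `1 / m`. -/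
theorem card_few_hits_le {ι D : Type*} [Fintype ι] [DecidableEq ι] [Fintype D] (H : Finset ι)
    (p : D → Prop) [DecidablePred p] {m μ : ℝ} (hm : 1 ≤ m) (hp : (#{d | p d} : ℝ) * m = Fintype.card D)
    (hμ : μ ≤ #H / m) :
    (#{x : ι → D | (#{v ∈ H | p (x v)} : ℝ) < μ / 2} : ℝ) ≤
      Real.exp (-(μ / 8)) * Fintype.card (ι → D) := by
  rcases lt_or_ge μ 0 with h0 | h0
  · rw [filter_false_of_mem fun x _ => not_lt.mpr (by
      have : (0 : ℝ) ≤ #{v ∈ H | p (x v)} := by positivity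
      linarith)]
    simp only [card_empty, Nat.cast_zero]
    positivity
  have hm0 : 0 < m := by linarith
  -- The product of these weights is `2 ^ (-hits)`; Markov's inequality is applied to it.
  let f : ι → D → ℝ := fun v d => if v ∈ H ∧ p d then 1 / 2 else 1
  have hf0 (v d) : 0 ≤ f v d := by simp only [f]; split_ifs <;> norm_num
  have hprod (x : ι → D) : ∏ v, f v (x v) = (1 / 2 : ℝ) ^ #{v ∈ H | p (x v)} := by
    rw [prod_ite, prod_const, prod_const_one, mul_one]
    congr 2
    ext v; simp
  have hsumf (v : ι) : ∑ d, f v d = Fintype.card D * (if v ∈ H then 1 - 1 / (2 * m) else 1) := by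
    by_cases hv : v ∈ H
    · have : ∀ d, f v d = 1 - (1 / 2) * (if p d then (1 : ℝ) else 0) := by
        intro d; simp only [f, hv, true_and]; split_ifs <;> norm_num
      simp only [this, sum_sub_distrib, ← mul_sum, sum_boole, hv, if_true]
      rw [sum_const, card_univ, nsmul_eq_mul, ← hp]
      field_simp
    · simp [f, hv]
  have hexp : ∀ x : ι → D, (if (#{v ∈ H | p (x v)} : ℝ) < μ / 2 then (1 : ℝ) else 0) ≤
      Real.exp (μ / 2 * Real.log 2) * ∏ v, f v (x v) := by
    intro x
    split_ifs with h
    · rw [hprod, one_div, inv_pow, ← Real.rpow_natCast, Real.rpow_def_of_pos (by norm_num),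
        ← Real.exp_neg, ← Real.exp_add, Real.one_le_exp_iff]
      have := Real.log_pos (show (1 : ℝ) < 2 by norm_num)
      nlinarith
    · exact mul_nonneg (Real.exp_pos _).le (prod_nonneg fun v _ => hf0 _ _)
  have hbase : 0 ≤ 1 - 1 / (2 * m) := by
    rw [sub_nonneg, div_le_one (by positivity)]; linarith
  calc (#{x : ι → D | (#{v ∈ H | p (x v)} : ℝ) < μ / 2} : ℝ)
      = ∑ x : ι → D, if (#{v ∈ H | p (x v)} : ℝ) < μ / 2 then (1 : ℝ) else 0 := by
        rw [sum_boole]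
    _ ≤ ∑ x : ι → D, Real.exp (μ / 2 * Real.log 2) * ∏ v, f v (x v) :=
        sum_le_sum fun x _ => hexp x
    _ = Real.exp (μ / 2 * Real.log 2) * ∏ v, ∑ d, f v d := by
        rw [← mul_sum, prod_univ_sum, Fintype.piFinset_univ]
    _ = Real.exp (μ / 2 * Real.log 2) * ((1 - 1 / (2 * m)) ^ #H * Fintype.card (ι → D)) := by
        simp only [hsumf, prod_mul_distrib, prod_const, card_univ, Fintype.card_fun]
        rw [prod_ite_mem, univ_inter, prod_const]
        push_cast
        ring
    _ ≤ Real.exp (μ / 2 * Real.log 2) * (Real.exp (-(μ / 2)) * Fintype.card (ι → D)) := by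
        gcongr
        calc (1 - 1 / (2 * m)) ^ #H ≤ Real.exp (-(1 / (2 * m))) ^ #H := by
              gcongr; exact Real.one_sub_le_exp_neg _
          _ = Real.exp (-(#H / m / 2)) := by
              rw [← Real.exp_nat_mul]; congr 1; field_simp
          _ ≤ _ := by gcongr
    _ ≤ _ := by
        rw [← mul_assoc, ← Real.exp_add]
        gcongr
        -- The exponent is `(log 2 - 1) / 2 * μ`, and `log 2 ≤ 3 / 4`.
        nlinarith [Real.log_two_lt_d9]

/-- If, for each choice of the other coordinates, a proportion of at most `ε` of the values of the
coordinate `t` are bad, then a proportion of at most `ε` of all points are bad. -/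
theorem card_filter_le_of_update {T E : Type*} [Fintype T] [DecidableEq T] [Fintype E]
    [Nonempty E]
    (t : T) (Q : (T → E) → Prop) {ε : ℝ}
    (h : ∀ ω : T → E, (#{x : E | Q (Function.update ω t x)} : ℝ) ≤ ε * Fintype.card E) :
    (#{ω : T → E | Q ω} : ℝ) ≤ ε * Fintype.card (T → E) := by
  let e := Equiv.funSplitAt t E
  let x₀ : E := Classical.arbitrary E
  have hupd (x : E) (r : {j // j ≠ t} → E) :
      e.symm (x, r) = Function.update (e.symm (x₀, r)) t x := by
    rw [Equiv.symm_apply_eq]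
    refine Prod.ext (by simp [e]) ?_
    ext j
    have := congrFun (congrArg Prod.snd (e.apply_symm_apply (x₀, r))) j
    change r j = Function.update (e.symm (x₀, r)) t x j
    rw [Function.update_of_ne j.2]
    exact this.symm
  have h1 : (#{ω : T → E | Q ω} : ℝ) = ∑ r : {j // j ≠ t} → E, ∑ x : E,
      if Q (Function.update (e.symm (x₀, r)) t x) then (1 : ℝ) else 0 := by
    rw [← sum_boole, ← e.symm.sum_comp, Fintype.sum_prod_type_right]
    exact sum_congr rfl fun r _ => sum_congr rfl fun x _ => by rw [hupd x r]
  have h2 : Fintype.card (T → E) = Fintype.card E * Fintype.card ({j // j ≠ t} → E) := by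
    rw [Fintype.card_congr e, Fintype.card_prod]
  rw [h1, h2]
  calc _ ≤ ∑ r : {j // j ≠ t} → E, ε * Fintype.card E := by
        refine sum_le_sum fun r _ => ?_
        rw [sum_boole]
        exact h _
    _ = _ := by
      rw [sum_const, card_univ, nsmul_eq_mul]; push_cast; ring

/-! ### Histories and their dependence on the coins -/

/-- The messages broadcast in the past rounds. -/
def messagesOf (h : History n k b) : List (Fin k → List Bool) := h.map fun r w => (r w).message

theorem map_received_localView (v : Fin k) (h : History n k b) :
    (localView v h).map LocalRound.received = messagesOf h := by
  simp [localView, messagesOf, Function.comp_def]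

theorem length_messagesOf (h : History n k b) : (messagesOf h).length = h.length := by
  simp [messagesOf]

namespace Protocol

variable (P : Protocol n k) {β : ℝ} (X : Input n) (A : Adversary n k P.coinBits β)

theorem length_history (ω : Fin P.rounds → Coins k P.coinBits) (t : ℕ) (ht : t ≤ P.rounds) :
    (P.history X A ω t ht).length = t := by
  induction t with
  | zero => rfl
  | succ t ih => simp [history, ih]

theorem length_pastOf (ω : Fin P.rounds → Coins k P.coinBits) (t : Fin P.rounds) :
    (P.pastOf X A ω t).length = t :=
  P.length_history X A ω t _

theorem history_congr {ω ω' : Fin P.rounds → Coins k P.coinBits} (t : ℕ) (ht : t ≤ P.rounds)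
    (h : ∀ s : Fin P.rounds, (s : ℕ) < t → ω s = ω' s) :
    P.history X A ω t ht = P.history X A ω' t ht := by
  induction t with
  | zero => rfl
  | succ t ih =>
    simp only [history]
    rw [ih (Nat.le_of_succ_le ht) fun s hs => h s (by omega), h ⟨t, ht⟩ (by simp)]

/-- This makes the corrupt set of round `t` independent of the coins of round `t`. -/
theorem pastOf_update (ω : Fin P.rounds → Coins k P.coinBits) (t : Fin P.rounds)
    (x : Coins k P.coinBits) : P.pastOf X A (Function.update ω t x) t = P.pastOf X A ω t :=
  P.history_congr X A _ _ fun s hs => Function.update_of_ne (by rintro rfl; simp at hs) _ _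

end Protocol

/-! ### Costs and correctness of an execution -/

section Execution

variable {γ β : ℝ} (X : Input n) (A : Adversary n k (downloadProtocol n k b γ).coinBits β)
  (ω : Fin (downloadProtocol n k b γ).rounds → Coins k (downloadProtocol n k b γ).coinBits)

/-- The default `false` for missing replies never shows, because only queried indices are announced.
-/
theorem honestRound_message (h : History n k b) (v : Fin k) (c : Fin b → Bool) :
    ((downloadProtocol n k b γ).honestRound X h v c).message =
      announce c (queryBlock b γ (messagesOf h) c) X := by
  rw [← map_received_localView v]
  refine announce_eq_iff.mpr fun i hi => ?_
  exact congrArg (fun o : Option Bool => o.getD false) (if_pos hi)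

theorem honestRound_replies (h : History n k b) (v : Fin k) (c : Fin b → Bool) :
    ((downloadProtocol n k b γ).honestRound X h v c).replies =
      fun i => if i ∈ queryBlock b γ (messagesOf h) c then some (X i) else none := by
  rw [← map_received_localView v]
  rfl

theorem card_query_pastOf_le (hγ : 0 < γ) (hγ1 : γ ≤ 1) (hk : 0 < k)
    (t : Fin (downloadProtocol n k b γ).rounds) (c : Fin b → Bool) :
    (#(queryBlock (n := n) b γ (messagesOf ((downloadProtocol n k b γ).pastOf X A ω t)) c) : ℝ) ≤
      n / 2 ^ b + 5 / γ := by
  refine card_queryBlock_le hγ hγ1 hk _ ?_ _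
  rw [length_messagesOf]
  exact (Protocol.length_pastOf _ _ _ _ _).le.trans (Nat.lt_succ_iff.mp t.2)

theorem queryCost_downloadProtocol_le (hγ : 0 < γ) (hγ1 : γ ≤ 1) (hk : 0 < k) (v : Fin k) :
    ((downloadProtocol n k b γ).queryCost X A ω v : ℝ) ≤ (b + 1) * (n / 2 ^ b + 5 / γ) := by
  rw [Protocol.queryCost]
  push_cast
  calc _ ≤ ∑ t : Fin (downloadProtocol n k b γ).rounds, ((n : ℝ) / 2 ^ b + 5 / γ) := by
        refine sum_le_sum fun t _ => ?_
        split_ifs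
        · have := card_query_pastOf_le X A ω hγ hγ1 hk t (ω t v)
          rw [← map_received_localView v] at this
          exact this
        · positivity
    _ = _ := by
      rw [sum_const, card_univ, Fintype.card_fin, nsmul_eq_mul]
      push_cast
      rfl

theorem messageSize_downloadProtocol_le (hγ : 0 < γ) (hγ1 : γ ≤ 1) (hk : 0 < k)
    (t : Fin (downloadProtocol n k b γ).rounds) (v : Fin k) :
    ((downloadProtocol n k b γ).messageSize X A ω t v : ℝ) ≤ b + (n / 2 ^ b + 5 / γ) := by
  have h := honestRound_message (b := b) (γ := γ) X ((downloadProtocol n k b γ).pastOf X A ω t) v (ω t v)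
  rw [Protocol.messageSize, h, length_announce]
  push_cast
  gcongr
  exact card_query_pastOf_le X A ω hγ hγ1 hk t (ω t v)

/-- In round `t` too few nonfaulty peers choose the block `j`. -/
def FewHits (t : Fin (downloadProtocol n k b γ).rounds) (j : ℕ) : Prop :=
  (#{v ∈ (A.corrupt ((downloadProtocol n k b γ).pastOf X A ω t))ᶜ |
    cell (b := b) (2 ^ (b - t)) (ω t v) = j} : ℝ) < γ * k / ((2 ^ (b - t) : ℕ) : ℝ) / 2

/-- Nonfaulty peers that draw block `j` support `X` there. Corrupt peers cannot remove this support.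
-/
theorem mem_candidates_history
    (hgood : ∀ (t : Fin (downloadProtocol n k b γ).rounds) (j : ℕ), (t : ℕ) < b →
      j < 2 ^ (b - t) → ¬ FewHits X A ω t j)
    (t : ℕ) (htb : t ≤ b) (ht : t ≤ (downloadProtocol n k b γ).rounds) :
    X ∈ candidates b γ (messagesOf ((downloadProtocol n k b γ).history X A ω t ht)) := by
  induction t with
  | zero => simp [Protocol.history, messagesOf, candidates, candidateState]
  | succ t ih =>
    have ht' : t ≤ (downloadProtocol n k b γ).rounds := Nat.le_of_succ_le ht
    specialize ih (by omega) ht'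
    have happ : messagesOf ((downloadProtocol n k b γ).history X A ω (t + 1) ht) =
        messagesOf ((downloadProtocol n k b γ).history X A ω t ht') ++
          [fun w => ((downloadProtocol n k b γ).nextRound X A
            ((downloadProtocol n k b γ).history X A ω t ht') (ω ⟨t, ht⟩) w).message] := by
      simp [Protocol.history, messagesOf]
    rw [happ, candidates_append, length_messagesOf, Protocol.length_history]
    refine mem_filter.mpr ⟨ih, fun j hj => ?_⟩
    have h := not_lt.mp (hgood ⟨t, ht⟩ j (by simpa using htb) hj)
    calc _ = γ * k / ((2 ^ (b - t) : ℕ) : ℝ) / 2 := by rw [div_div, mul_comm (2 : ℝ)]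
      _ ≤ _ := h
      _ ≤ _ := by
        norm_cast
        refine card_le_card fun v hv => ?_
        obtain ⟨hv1, hv2⟩ := mem_filter.mp hv
        refine mem_filter.mpr ⟨mem_univ _, ω ⟨t, ht⟩ v, hv2, ?_⟩
        rw [mem_compl] at hv1
        refine (congrArg PeerRound.message (if_neg hv1)).trans ?_
        refine (honestRound_message (b := b) X _ v _).trans ?_
        rw [queryBlock, length_messagesOf, Protocol.length_history]
        exact congrArg (fun j => announce _ (block _ _ j) X) hv2

theorem solvesDownload_of_not_fewHits
    (hgood : ∀ (t : Fin (downloadProtocol n k b γ).rounds) (j : ℕ), (t : ℕ) < b →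
      j < 2 ^ (b - t) → ¬ FewHits X A ω t j) :
    (downloadProtocol n k b γ).SolvesDownload X A ω := by
  intro v hv
  have hb : b < (downloadProtocol n k b γ).rounds := Nat.lt_succ_self b
  have hX := mem_candidates_history X A ω hgood b le_rfl hb.le
  have hnf := hv ⟨b, hb⟩ rfl
  set past := (downloadProtocol n k b γ).history X A ω b hb.le with hpast
  -- After `b` rounds the number of blocks is `2 ^ 0 = 1`, so the coins no longer matter.
  have hQ : ∀ c, queryBlock (n := n) b γ (messagesOf past) c =
      sepSet (candidates b γ (messagesOf past)) := by
    intro c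
    have hlen : (messagesOf past).length = b := by
      rw [length_messagesOf, hpast, Protocol.length_history]
    simp [queryBlock, hlen, cell, Nat.mod_one, block_one]
  have hview : localView v ((downloadProtocol n k b γ).history X A ω _ le_rfl) =
      localView v past ++ localView v [(downloadProtocol n k b γ).nextRound X A past
        (ω ⟨b, hb⟩)] := by
    rw [localView, localView, localView, ← List.map_append]; rfl
  have hrep : ((downloadProtocol n k b γ).nextRound X A past (ω ⟨b, hb⟩) v).replies =
      fun i => if i ∈ sepSet (candidates b γ (messagesOf past)) then some (X i) else none := by
    have h1 : v ∉ A.corrupt past := hnf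
    refine (congrArg PeerRound.replies (if_neg h1)).trans ?_
    refine (honestRound_replies (b := b) X _ v _).trans ?_
    rw [hQ]
  have hcand : ∀ Y : Input n, (∃ l' r, localView v past ++ localView v
      [(downloadProtocol n k b γ).nextRound X A past (ω ⟨b, hb⟩)] = l' ++ [r] ∧
      Y ∈ candidates b γ (l'.map LocalRound.received) ∧ ∀ i x, r.replies i = some x → Y i = x) ↔
      Y ∈ candidates b γ (messagesOf past) ∧
        ∀ i ∈ sepSet (candidates b γ (messagesOf past)), Y i = X i := by
    intro Y
    constructor
    · rintro ⟨l', r, heq, hY, hr⟩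
      obtain ⟨rfl, h2⟩ := List.append_inj' heq rfl
      rw [map_received_localView] at hY
      obtain rfl := (List.singleton_inj.mp h2).symm
      refine ⟨hY, fun i hi => hr i _ ?_⟩
      simp only [hrep, if_pos hi]
    · rintro ⟨hY, hag⟩
      refine ⟨localView v past, _, rfl, by rwa [map_received_localView], fun i x hx => ?_⟩
      simp only [hrep] at hx
      split_ifs at hx with hi
      rw [hag i hi]
      exact Option.some.inj hx
  rw [hview]
  simp only [downloadProtocol] at hcand ⊢
  simp only [hcand]
  obtain ⟨h1, h2⟩ := Classical.epsilon_spec (p := fun Y : Input n =>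
    Y ∈ candidates b γ (messagesOf past) ∧
      ∀ i ∈ sepSet (candidates b γ (messagesOf past)), Y i = X i) ⟨X, hX, fun _ _ => rfl⟩
  exact isSeparating_sepSet _ _ h1 _ hX h2

end Execution

/-! ### Failure probability -/

theorem card_fewHits_le {β : ℝ} (hβ : β ≤ 1) (X : Input n)
    (A : Adversary n k (downloadProtocol n k b (1 - β)).coinBits β)
    (t : Fin (downloadProtocol n k b (1 - β)).rounds) {j : ℕ} (hj : j < 2 ^ (b - t)) :
    (#{ω : Fin (downloadProtocol n k b (1 - β)).rounds →
      Coins k (downloadProtocol n k b (1 - β)).coinBits | FewHits X A ω t j} : ℝ) ≤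
    Real.exp (-((1 - β) * k / 2 ^ b / 8)) *
      Fintype.card (Fin (downloadProtocol n k b (1 - β)).rounds →
        Coins k (downloadProtocol n k b (1 - β)).coinBits) := by
  refine card_filter_le_of_update (E := Coins k (downloadProtocol n k b (1 - β)).coinBits) t
    (fun ω => FewHits X A ω t j) fun ω => ?_
  obtain ⟨H, hH⟩ : ∃ H, (A.corrupt ((downloadProtocol n k b (1 - β)).pastOf X A ω t))ᶜ = H :=
    ⟨_, rfl⟩
  have hfew (x : Coins k b) : FewHits X A (Function.update ω t x) t j ↔
      (#{v ∈ H | cell (2 ^ (b - t)) (x v) = j} : ℝ) <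
        (1 - β) * k / ((2 ^ (b - t) : ℕ) : ℝ) / 2 := by
    have h := Protocol.pastOf_update (downloadProtocol n k b (1 - β)) X A ω t x
    rw [FewHits, h, hH, Function.update_self]
  have hcard : (1 - β) * k ≤ #H := by
    have h1 := A.corrupt_card_le ((downloadProtocol n k b (1 - β)).pastOf X A ω t)
    have h2 := card_add_card_compl (A.corrupt ((downloadProtocol n k b (1 - β)).pastOf X A ω t))
    rw [hH, Fintype.card_fin] at h2
    have h3 : (#(A.corrupt ((downloadProtocol n k b (1 - β)).pastOf X A ω t)) : ℝ) + #H = k := by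
      exact_mod_cast h2
    linarith
  have hm : (1 : ℝ) ≤ ((2 ^ (b - t) : ℕ) : ℝ) := by exact_mod_cast Nat.one_le_two_pow
  have hp : (#{c : Fin b → Bool | cell (2 ^ (b - t)) c = j} : ℝ) * ((2 ^ (b - t) : ℕ) : ℝ) =
      Fintype.card (Fin b → Bool) := by
    rw [Fintype.card_fun, Fintype.card_bool, Fintype.card_fin]
    exact_mod_cast card_cell_eq (pow_dvd_pow 2 (Nat.sub_le b t)) hj
  have hμ : (1 - β) * k / ((2 ^ (b - t) : ℕ) : ℝ) ≤ #H / ((2 ^ (b - t) : ℕ) : ℝ) := by gcongr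
  -- The first round has the most blocks, hence the weakest bound, which serves for all rounds.
  have hexp : Real.exp (-((1 - β) * k / ((2 ^ (b - t) : ℕ) : ℝ) / 8)) ≤
      Real.exp (-((1 - β) * k / 2 ^ b / 8)) := by
    have : 0 ≤ 1 - β := by linarith
    push_cast
    gcongr
    · norm_num
    · exact Nat.sub_le _ _
  have hfilter : (univ.filter fun x : Coins k b => FewHits X A (Function.update ω t x) t j) =
      univ.filter fun x : Coins k b => (#{v ∈ H | cell (2 ^ (b - t)) (x v) = j} : ℝ) <
        (1 - β) * k / ((2 ^ (b - t) : ℕ) : ℝ) / 2 :=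
    filter_congr fun x _ => hfew x
  have hchernoff := (card_few_hits_le H (fun c => cell (2 ^ (b - t)) c = j) hm hp hμ).trans
    (mul_le_mul_of_nonneg_right hexp (Nat.cast_nonneg _))
  rw [← hfilter] at hchernoff
  exact hchernoff

theorem one_sub_le_successProb {β : ℝ} (hβ : β ≤ 1) (X : Input n)
    (A : Adversary n k (downloadProtocol n k b (1 - β)).coinBits β) :
    1 - 2 * (2 ^ b - 1) * Real.exp (-((1 - β) * k / 2 ^ b / 8)) ≤
      (downloadProtocol n k b (1 - β)).successProb X A := by
  let P := downloadProtocol n k b (1 - β)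
  set ε := Real.exp (-((1 - β) * k / 2 ^ b / 8))
  set N : ℝ := (Fintype.card (Fin P.rounds → Coins k P.coinBits) : ℝ) with hN
  have hNpos : 0 < N := by
    rw [hN]; exact_mod_cast Fintype.card_pos
  let I : Finset (Σ _ : Fin P.rounds, ℕ) :=
    ({t | (t : ℕ) < b} : Finset (Fin P.rounds)).sigma fun t => range (2 ^ (b - t))
  -- The geometric sum `2 ^ b + ... + 2`; the final round with one block cannot fail and is left
  -- out.
  have hI : (#I : ℝ) ≤ 2 * (2 ^ b - 1) := by
    have h1 : #I = ∑ t ∈ range b, 2 ^ (b - t) := by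
      rw [card_sigma]
      simp only [card_range]
      refine sum_bij (fun t _ => (t : ℕ)) (by simp) (fun a _ a' _ h => Fin.ext h) ?_ (by simp)
      intro t ht
      exact ⟨⟨t, Nat.lt_succ_of_lt (mem_range.mp ht)⟩, by simpa using ht, rfl⟩
    have h2 : ∀ m : ℕ, ∑ t ∈ range m, 2 ^ (m - t) + 2 = 2 * 2 ^ m := by
      intro m
      induction m with
      | zero => simp
      | succ m ih =>
        rw [sum_range_succ']
        simp only [Nat.add_sub_add_right, Nat.sub_zero]
        rw [pow_succ]
        omega
    have h3 : (#I : ℝ) + 2 = 2 * 2 ^ b := by rw [h1]; exact_mod_cast h2 b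
    linarith
  have hbad : (#{ω | ¬ P.SolvesDownload X A ω} : ℝ) ≤ 2 * (2 ^ b - 1) * ε * N := by
    have hsub : ({ω | ¬ P.SolvesDownload X A ω} : Finset (Fin P.rounds → Coins k P.coinBits)) ⊆
        I.biUnion fun p => {ω | FewHits X A ω p.1 p.2} := by
      intro ω hω
      by_contra hcon
      refine (mem_filter.mp hω).2 (solvesDownload_of_not_fewHits X A ω fun t j ht hj hfew => ?_)
      exact hcon (mem_biUnion.mpr ⟨⟨t, j⟩, mem_sigma.mpr ⟨by simpa using ht, by simpa using hj⟩,
        by simpa using hfew⟩)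
    calc (#{ω | ¬ P.SolvesDownload X A ω} : ℝ)
        ≤ ∑ p ∈ I, (#{ω | FewHits X A ω p.1 p.2} : ℝ) := by
          exact_mod_cast (card_le_card hsub).trans card_biUnion_le
      _ ≤ ∑ p ∈ I, ε * N := sum_le_sum fun p hp =>
          card_fewHits_le hβ X A p.1 (mem_range.mp (mem_sigma.mp hp).2)
      _ = #I * (ε * N) := by simp
      _ ≤ 2 * (2 ^ b - 1) * (ε * N) := by gcongr
      _ = _ := by ring
  have hsplit : (#{ω | P.SolvesDownload X A ω} : ℝ) + #{ω | ¬ P.SolvesDownload X A ω} = N := by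
    rw [hN, ← card_univ]
    exact_mod_cast card_filter_add_card_filter_not _
  rw [Protocol.successProb, Nat.card_eq_fintype_card, Nat.card_eq_fintype_card, ← hN,
    Fintype.card_subtype, le_div_iff₀ hNpos]
  linarith

end DataRetrieval

/-! ### Choice of parameters -/

theorem mainTheorem5 (c : ℝ) (hc : 0 < c) :
    ∃ C : ℝ, 0 < C ∧
      ∀ (n k : ℕ) (β : ℝ), 2 ≤ n → 1 ≤ k → k ≤ n → 0 ≤ β → β < 1 →
        ∃ P : DataRetrieval.Protocol n k,
          (P.rounds : ℝ) ≤ C * Real.log n ^ 2 ∧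
          ∀ (X : DataRetrieval.Input n) (A : DataRetrieval.Adversary n k P.coinBits β),
            (∀ (ω : Fin P.rounds → DataRetrieval.Coins k P.coinBits) (v : Fin k),
              (P.queryCost X A ω v : ℝ) ≤ C * (n / ((1 - β) * k)) * Real.log n ^ 2) ∧
            (∀ (ω : Fin P.rounds → DataRetrieval.Coins k P.coinBits) (t : Fin P.rounds)
              (v : Fin k), P.Nonfaulty X A ω t v →
                (P.messageSize X A ω t v : ℝ) ≤ C * (n / ((1 - β) * k)) * Real.log n) ∧
            1 - (n : ℝ) ^ (-c) ≤ P.successProb X A := by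
  -- The 8 cancels the Chernoff constant; `c + 2` leaves a factor `n ^ 2` for the union bound.
  set C₁ : ℝ := 8 * (c + 2) with hC₁
  refine ⟨3 * (2 * C₁ + 8), by positivity, fun n k β hn hk hkn hβ0 hβ1 => ?_⟩
  set γ : ℝ := 1 - β with hγdef
  have hγ : 0 < γ := by linarith
  have hγ1 : γ ≤ 1 := by linarith
  have hk' : (1 : ℝ) ≤ k := by exact_mod_cast hk
  have hkn' : (k : ℝ) ≤ n := by exact_mod_cast hkn
  have hn' : (2 : ℝ) ≤ n := by exact_mod_cast hn
  have hlog2 := Real.log_two_gt_d9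
  set L := Real.log n with hLdef
  have hL : Real.log 2 ≤ L := Real.log_le_log (by norm_num) hn'
  have hL0 : 0 < L := by linarith
  set q : ℝ := γ * k / (C₁ * L) with hq
  -- `2 ^ b` is the largest power of two up to `q`. If `q < 2`, also for `⌊q⌋₊ = 0`, this gives `b =
  -- 0`: a single round in which everything is queried.
  set b : ℕ := Nat.log 2 ⌊q⌋₊ with hb
  have hC₁L : 1 ≤ C₁ * L := by nlinarith
  have hqn : q ≤ n := by
    rw [hq, div_le_iff₀ (by positivity)]
    nlinarith
  have hq_lt : q < 2 * 2 ^ b := by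
    have h1 : ⌊q⌋₊ + 1 ≤ 2 ^ (b + 1) := Nat.lt_pow_succ_log_self (by norm_num) _
    have h2 : ((⌊q⌋₊ : ℝ) + 1) ≤ 2 ^ (b + 1) := by exact_mod_cast h1
    rw [pow_succ'] at h2
    linarith [Nat.lt_floor_add_one q]
  have hb_le : b ≠ 0 → (2 : ℝ) ^ b ≤ q := by
    intro hb0
    have hfl : ⌊q⌋₊ ≠ 0 := by
      intro h
      rw [h] at hb
      exact hb0 (by simpa using hb)
    have h1 : 2 ^ b ≤ ⌊q⌋₊ := Nat.pow_log_le_self 2 hfl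
    have h2 : (2 : ℝ) ^ b ≤ (⌊q⌋₊ : ℝ) := by exact_mod_cast h1
    exact h2.trans (Nat.floor_le (by positivity))
  have hbn : (2 : ℝ) ^ b ≤ n := by
    by_cases hb0 : b = 0
    · rw [hb0]; linarith
    · exact (hb_le hb0).trans hqn
  have hbL : b * Real.log 2 ≤ L := by
    rw [← Real.log_pow]
    exact Real.log_le_log (by positivity) hbn
  -- Both `b` and `1` are at most `L / log 2`, and `2 / log 2 < 3`.
  have hb3 : (b : ℝ) + 1 ≤ 3 * L := by nlinarith
  set R : ℝ := n / (γ * k) with hR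
  have hRγ : 1 / γ ≤ R := by
    rw [hR, div_le_div_iff₀ hγ (by positivity)]
    nlinarith
  have hR1 : 1 ≤ R := hRγ.trans' (by rw [le_div_iff₀ hγ]; linarith)
  have hblock : (n : ℝ) / 2 ^ b + 5 / γ ≤ (2 * C₁ + 8) * (L * R) := by
    have h1 : (n : ℝ) / 2 ^ b ≤ 2 * C₁ * (L * R) := by
      rw [div_le_iff₀ (by positivity)]
      have h2 : γ * k ≤ 2 * 2 ^ b * (C₁ * L) := by
        rw [hq, div_lt_iff₀ (by positivity)] at hq_lt
        exact hq_lt.le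
      calc (n : ℝ) = R * (γ * k) := by rw [hR]; field_simp
        _ ≤ R * (2 * 2 ^ b * (C₁ * L)) := by gcongr
        _ = _ := by ring
    have h3 : 5 / γ ≤ 8 * (L * R) := by
      have : 5 / γ = 5 * (1 / γ) := by ring
      rw [this]
      nlinarith
    linarith
  have hLR : L ≤ L * R := le_mul_of_one_le_right hL0.le hR1
  refine ⟨DataRetrieval.downloadProtocol n k b γ, ?_, fun X A => ⟨fun ω v => ?_, fun ω t v _ => ?_,
    ?_⟩⟩
  · push_cast
    nlinarith
  · refine (DataRetrieval.queryCost_downloadProtocol_le X A ω hγ hγ1 hk v).trans ?_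
    calc ((b : ℝ) + 1) * (n / 2 ^ b + 5 / γ) ≤ (3 * L) * ((2 * C₁ + 8) * (L * R)) := by gcongr
      _ = _ := by ring
  · refine (DataRetrieval.messageSize_downloadProtocol_le X A ω hγ hγ1 hk t v).trans ?_
    have h1 : (b : ℝ) ≤ 3 * (L * R) := by linarith
    have h2 : 3 * (L * R) ≤ 2 * (2 * C₁ + 8) * (L * R) := by gcongr; linarith
    linarith
  · refine le_trans ?_ (DataRetrieval.one_sub_le_successProb hβ1.le X A)
    -- For `b = 0` the factor `2 ^ b - 1` vanishes, so success is certain; the bound `2 ^ b ≤ q` is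
    -- available only for `b ≠ 0`.
    by_cases hb0 : b = 0
    · rw [hb0]
      have : 0 ≤ (n : ℝ) ^ (-c) := by positivity
      simpa using this
    · have h1 : C₁ * L ≤ γ * k / 2 ^ b := by
        rw [le_div_iff₀ (by positivity), mul_comm, ← le_div_iff₀ (by positivity)]
        exact hb_le hb0
      have h2 : 2 * ((2 : ℝ) ^ b - 1) ≤ (n : ℝ) ^ (2 : ℝ) := by
        rw [Real.rpow_two]
        nlinarith
      have h3 : Real.exp (-(γ * k / 2 ^ b / 8)) ≤ (n : ℝ) ^ (-(c + 2)) := by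
        rw [Real.rpow_def_of_pos (by linarith)]
        gcongr
        linarith
      have h4 : 2 * ((2 : ℝ) ^ b - 1) * Real.exp (-(γ * k / 2 ^ b / 8)) ≤ (n : ℝ) ^ (-c) := by
        calc _ ≤ (n : ℝ) ^ (2 : ℝ) * (n : ℝ) ^ (-(c + 2)) := by gcongr
          _ = (n : ℝ) ^ (-c) := by
            rw [← Real.rpow_add (by linarith)]
            ring_nf
      linarith
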